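/- **Theorem 3.4.** For a natural number $n$ let $\mathsf L_n=\{k n^{-n}: k\in\mathbb Z,\ 1\le k\le n^{2n}\}\subset\mathbb R$ with the cyclic metric $\chi(x,y)=\min\{|x-y|,\,n^n-|x-y|\}$, let $\mathsf M_n=\prod_{i=1}^{n^n}\mathsf L_n$ with the supremum metric $d_\infty(x,y)=\max_i\chi(x_i,y_i)$, and let $\mathsf M_n^*$ be the subspace of $\mathsf M_n$ consisting of the points all of whose coordinates are integers. The generalized roundness $\mathfrak q(X)\in[0,\infty]$ of a metric space $(X,d)$ is the supremum of the set of all $p\ge 0$ such that for all integers $m\ge 2$ and all (not necessarily distinct) points $x_1,\dots,x_m,y_1,\dots,y_m\in X$, $$\sum_{1\le i<j\le m}\bigl\{d(x_i,x_j)^p+d(y_i,y_j)^p\bigr\}\ \le\ \sum_{1\le i,j\le m}d(x_i,y_j)^p .$$ A map $f$ from a metric space $(X,d)$ to a metric space $(Y,\varsigma)$ is a coarse embedding if there are non-decreasing functions $\rho_1,\rho_2:[0,\infty)\to[0,\infty)$ with $\rho_1(d(x,y))\le\varsigma(f(x),f(y))\le\rho_2(d(x,y))$ for all $x,y\in X$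 and $\lim_{t\to\infty}\rho_1(t)=\infty$. For a generating set $\Sigma$ of an abelian group $G$, let $\mathrm{Cay}(G,\Sigma)$ be the Cayley graph of $G$ with respect to $\Sigma$, regarded as the metric space with point set $G$ and the graph metric (two distinct elements $u,v$ are adjacent if and only if $v-u\in\Sigma$ or $u-v\in\Sigma$). Then there exists a generating set $\Sigma$ of $\mathbb Z_\omega=\bigoplus_{\aleph_0}\mathbb Z$ such that 1. for arbitrarily large even $n$, the space $\mathrm{Cay}(\mathbb Z_\omega,\Sigma)$ contains an isometric copy of $\mathsf M_n^*$; and 2. $\mathrm{Cay}(\mathbb Z_\omega,\Sigma)$ does not coarsely embed into any metric space $B$ with $\mathfrak q(B)\neq 0$. -/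

import Mathlib

open scoped NNReal ENNReal

namespace Roundness

/-- The set `L_n = {k n⁻ⁿ : 1 ≤ k ≤ n²ⁿ}` of real numbers. It is a type of its own, so that it does
not carry the metric of `ℝ`. -/
def CyclicSet (n : ℕ) : Type :=
  {x : ℝ // ∃ k : ℕ, 1 ≤ k ∧ k ≤ n ^ (2 * n) ∧ x = (k : ℝ) / (n : ℝ) ^ n}

namespace CyclicSet

/-- The real number underlying a point of `L_n`. -/
def val {n : ℕ} (x : CyclicSet n) : ℝ := Subtype.val x

theorem ext {n : ℕ} {x y : CyclicSet n} (h : x.val = y.val) : x = y := Subtype.ext h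

/-- The cyclic metric `χ(x, y) = min (|x - y|, nⁿ - |x - y|)`. -/
noncomputable def chi {n : ℕ} (x y : CyclicSet n) : ℝ :=
  min |x.val - y.val| ((n : ℝ) ^ n - |x.val - y.val|)

theorem pow_self_pos (n : ℕ) : (0 : ℝ) < (n : ℝ) ^ n := by
  rcases Nat.eq_zero_or_pos n with rfl | h
  · simp
  · positivity

theorem val_pos {n : ℕ} (x : CyclicSet n) : 0 < x.val := by
  obtain ⟨k, hk, -, hx⟩ := x.2
  have h1 : (0 : ℝ) < k := by exact_mod_cast hk
  have h2 : x.val = (k : ℝ) / (n : ℝ) ^ n := hx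
  rw [h2]
  exact div_pos h1 (pow_self_pos n)

theorem val_le {n : ℕ} (x : CyclicSet n) : x.val ≤ (n : ℝ) ^ n := by
  obtain ⟨k, -, hk, hx⟩ := x.2
  have h1 : (k : ℝ) ≤ (n : ℝ) ^ (2 * n) := by exact_mod_cast hk
  have h2 : x.val = (k : ℝ) / (n : ℝ) ^ n := hx
  rw [h2, div_le_iff₀ (pow_self_pos n), ← pow_add, ← two_mul]
  exact h1

theorem abs_lt {n : ℕ} (x y : CyclicSet n) : |x.val - y.val| < (n : ℝ) ^ n := by
  rw [abs_sub_lt_iff]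
  constructor <;> linarith [x.val_pos, y.val_pos, x.val_le, y.val_le]

noncomputable instance (n : ℕ) : MetricSpace (CyclicSet n) where
  dist := chi
  dist_self x := by
    simp [chi, (pow_self_pos n).le]
  dist_comm x y := by
    simp only [chi, abs_sub_comm]
  dist_triangle x y z := by
    have h1 := abs_lt x y
    have h2 := abs_lt y z
    have h3 := abs_lt x z
    simp only [chi]
    grind
  eq_of_dist_eq_zero {x y} h := by
    have h1 := abs_lt x y
    have h2 : chi x y = 0 := h
    apply ext
    simp only [chi] at h2
    grind

theorem dist_def {n : ℕ} (x y : CyclicSet n) :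
    dist x y = min |x.val - y.val| ((n : ℝ) ^ n - |x.val - y.val|) := rfl

end CyclicSet

/-- `M_n`: the product of `nⁿ` copies of `L_n`. Its metric is Mathlib's metric on finite products,
that is, the maximum of the coordinate distances. -/
abbrev ProdSpace (n : ℕ) : Type := Fin (n ^ n) → CyclicSet n

/-- `M_n^*`: the points of `M_n` with integer coordinates, with the metric of `M_n`. -/
abbrev IntegerPoints (n : ℕ) : Type :=
  {x : ProdSpace n // ∀ i, ∃ z : ℤ, (x i).val = (z : ℝ)}

/-- The generalized roundness inequality with exponent `p` for all double-`n`-simplices, `n ≥ 2`. -/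
def HasRoundnessExponent (X : Type*) [MetricSpace X] (p : ℝ≥0) : Prop :=
  ∀ n : ℕ, 2 ≤ n → ∀ x y : Fin n → X,
    ∑ i, ∑ j ∈ Finset.Ioi i, (dist (x i) (x j) ^ (p : ℝ) + dist (y i) (y j) ^ (p : ℝ)) ≤
      ∑ i, ∑ j, dist (x i) (y j) ^ (p : ℝ)

/-- The generalized roundness `𝔮(X) ∈ [0, ∞]`: the supremum of all exponents `p ≥ 0` for which the
inequality holds. -/
noncomputable def generalizedRoundness (X : Type*) [MetricSpace X] : ℝ≥0∞ :=
  ⨆ (p : ℝ≥0) (_ : HasRoundnessExponent X p), (p : ℝ≥0∞)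

/-- Coarse embeddings of metric spaces. -/
def IsCoarseEmbedding {X Y : Type*} [MetricSpace X] [MetricSpace Y] (f : X → Y) : Prop :=
  ∃ ρ₁ ρ₂ : ℝ≥0 → ℝ≥0, Monotone ρ₁ ∧ Monotone ρ₂ ∧
    (∀ x y : X, ρ₁ (nndist x y) ≤ nndist (f x) (f y) ∧ nndist (f x) (f y) ≤ ρ₂ (nndist x y)) ∧
    Filter.Tendsto ρ₁ Filter.atTop Filter.atTop

theorem addCayley_connected {G : Type*} [AddGroup G] {S : Set G}
    (hS : AddSubgroup.closure S = ⊤) : (SimpleGraph.addCayley S).Connected := by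
  have step : ∀ a g : G, g ∈ S → (SimpleGraph.addCayley S).Reachable a (a + g) := by
    intro a g hg
    by_cases h : a = a + g
    · rw [← h]
    · exact SimpleGraph.Adj.reachable ((SimpleGraph.addCayley_adj' S _ _).2
        ⟨h, g, hg, Or.inl rfl⟩)
  have key : ∀ g : G, ∀ a : G, (SimpleGraph.addCayley S).Reachable a (a + g) := by
    intro g
    have hg : g ∈ AddSubgroup.closure S := by rw [hS]; trivial
    induction hg using AddSubgroup.closure_induction with
    | mem g hg => exact fun a => step a g hg
    | zero => intro a; rw [add_zero]
    | add g h _ _ ihg ihh => intro a; rw [← add_assoc]; exact (ihg a).trans (ihh _)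
    | neg g _ ih => intro a; simpa using (ih (a + -g)).symm
  have : Nonempty G := ⟨0⟩
  refine ⟨fun a b => ?_⟩
  simpa using key (-a + b) a

/-- The vertex set of the Cayley graph `Cay(G, S)` of the group `G` with respect to the generating
set `S`. It carries the graph metric. -/
def Cay {G : Type*} [AddGroup G] (S : Set G) (_hS : AddSubgroup.closure S = ⊤) : Type _ := G

/-- The group element underlying a vertex of the Cayley graph. -/
def Cay.val {G : Type*} [AddGroup G] {S : Set G} {hS : AddSubgroup.closure S = ⊤}
    (x : Cay S hS) : G := x

noncomputable instance {G : Type*} [AddGroup G] (S : Set G) (hS : AddSubgroup.closure S = ⊤) :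
    MetricSpace (Cay S hS) where
  dist x y := ((SimpleGraph.addCayley S).dist x.val y.val : ℝ)
  dist_self x := by rw [SimpleGraph.dist_self, Nat.cast_zero]
  dist_comm x y := by rw [SimpleGraph.dist_comm]
  dist_triangle x y z := by exact_mod_cast (addCayley_connected hS).dist_triangle
  eq_of_dist_eq_zero {x y} h := by
    have h' : x.val = y.val := (addCayley_connected hS).dist_eq_zero_iff.1 (by exact_mod_cast h)
    exact h'

theorem Cay.dist_def {G : Type*} [AddGroup G] {S : Set G} {hS : AddSubgroup.closure S = ⊤}
    (x y : Cay S hS) : dist x y = ((SimpleGraph.addCayley S).dist x.val y.val : ℝ) := rfl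

end Roundness

/-!
The disjoint union of the spaces `M_n^*` is countable, so its points index a basis of `⨁ ℤ`. The
generators are the differences `e_x - e_y` for points `x`, `y` of the same `M_n^*` at distance at
most `1`, together with one basis vector for each `n`. Since `M_n^*` is the vertex set of a graph
with its graph metric, `e_x` and `e_y` are joined by a path of length `d(x, y)` in the Cayley graph;
no path is shorter, because the `1`-Lipschitz function `d(x, ·)` on `M_n^*`, normalized at the base
point and continued by zero to the other blocks, extends to a homomorphism to `ℝ` which is bounded
by `1` on the generators (`dist_le_addCayley_dist_pointVector`). Hence every `M_n^*` embeds
isometrically (`exists_generating_set_isometry`).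

The obstruction is Enflo's averaging argument on the torus `(ℤ/N)^N`, `N = nⁿ`, which is `M_n^*`
with its maximum metric (`dist_torusPoint_le_iff`). Let `F` map the torus to a space with roundness
exponent `p > 0`, and average `d(F(g), F(g + v))^p` over all translations and all signed
permutations of the coordinates. The result depends only on the shape of `v`: the number `s` of its
non-zero coordinates, if these are all `±r`. It still satisfies the roundness inequality. Applied to
a suitable configuration of `2m` points, whose cross differences have shape `(2mt, r)` and whose
other differences have shape `(2t, 2r)`, the inequality says that the average for `(2t, 2r)` is at
most `m / (m - 1)` times the average for `(2mt, r)` (`averagedPower_double`). After `k` steps with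
`m = k + 2`, starting from `(2m^k, 1)`, the average at distance `2^k` is at most
`(m / (m - 1))^k ≤ 3` times the average at distance `1`. A coarse embedding violates this for large
`k`, once `n` is so large that the torus has room for these shapes and for the distance `2^k`
(`not_isCoarseEmbedding_of_isometry`).
-/

namespace Roundness

/-! ### Cayley graphs containing a sequence of geodesic spaces -/

/-- A discrete form of geodesicity: from `x`, a step of length at most `1` decreases an upper bound
`k + 1` for the distance to `y` by `1`. -/
def HasUnitSteps (X : Type*) [MetricSpace X] : Prop :=
  ∀ (k : ℕ) (x y : X), dist x y ≤ k + 1 → ∃ z, dist x z ≤ 1 ∧ dist z y ≤ k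

/-- Homomorphisms to `ℝ` that are bounded by `1` on the generators are `1`-Lipschitz for the graph
metric. -/
theorem abs_sub_le_addCayley_dist {G : Type*} [AddCommGroup G] {S : Set G}
    (hS : (SimpleGraph.addCayley S).Connected) (h : G →+ ℝ) (hh : ∀ s ∈ S, |h s| ≤ 1) (x y : G) :
    |h x - h y| ≤ (SimpleGraph.addCayley S).dist x y := by
  obtain ⟨w, hw⟩ := hS.exists_walk_length_eq_dist x y
  rw [← hw]
  clear hw
  induction w with
  | nil => simp
  | @cons u v w huv p ih =>
    have step : |h u - h v| ≤ 1 := by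
      obtain ⟨-, g, hg, rfl | rfl⟩ := (SimpleGraph.addCayley_adj' S _ _).1 huv
      · simpa using hh g hg
      · simpa using hh g hg
    rw [SimpleGraph.Walk.length_cons]
    push_cast
    linarith [abs_sub_le (h u) (h v) (h w)]

section Generators

variable {X : ℕ → Type*} [∀ n, MetricSpace (X n)] (e : (Σ n, X n) ≃ ℕ) (b : ∀ n, X n)

/-- The basis vector of `⨁ ℤ` attached to a point of the disjoint union of the spaces `X n`, where
`e` enumerates that disjoint union. -/
noncomputable def pointVector (n : ℕ) (x : X n) : ℕ →₀ ℤ := Finsupp.single (e ⟨n, x⟩) 1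

/-- The differences of basis vectors attached to points of the same space at distance at most `1`,
together with one basis vector for each space. -/
def blockGenerators : Set (ℕ →₀ ℤ) :=
  {s | ∃ n, ∃ x y : X n, dist x y ≤ 1 ∧ s = pointVector e n x - pointVector e n y} ∪
    {s | ∃ n, s = pointVector e n (b n)}

variable {e b}

theorem pointVector_sub_mem_closure {n : ℕ} (hX : HasUnitSteps (X n)) (k : ℕ) :
    ∀ x y : X n, dist x y ≤ k →
      pointVector e n x - pointVector e n y ∈ AddSubgroup.closure (blockGenerators e b) := by
  induction k with
  | zero =>
    intro x y h
    obtain rfl : x = y := dist_le_zero.1 (by exact_mod_cast h)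
    rw [sub_self]
    exact zero_mem _
  | succ k ih =>
    intro x y h
    obtain ⟨z, h1, h2⟩ := hX k x y (by exact_mod_cast h)
    rw [← sub_add_sub_cancel _ (pointVector e n z)]
    exact add_mem (AddSubgroup.subset_closure (Or.inl ⟨n, x, z, h1, rfl⟩)) (ih z y h2)

theorem closure_blockGenerators (hX : ∀ n, HasUnitSteps (X n)) :
    AddSubgroup.closure (blockGenerators e b) = ⊤ := by
  rw [eq_top_iff]
  rintro v -
  induction v using Finsupp.induction_linear with
  | zero => exact zero_mem _
  | add f g hf hg => exact add_mem hf hg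
  | single a z =>
    obtain ⟨⟨n, x⟩, rfl⟩ := e.surjective a
    obtain ⟨k, hk⟩ := exists_nat_ge (dist x (b n))
    have h1 := pointVector_sub_mem_closure (e := e) (b := b) (hX n) k x (b n) hk
    have h2 : pointVector e n (b n) ∈ AddSubgroup.closure (blockGenerators e b) :=
      AddSubgroup.subset_closure (Or.inr ⟨n, rfl⟩)
    have h3 := zsmul_mem (add_mem h1 h2) z
    rw [sub_add_cancel] at h3
    simpa [pointVector] using h3

theorem addCayley_dist_pointVector_le {n : ℕ} (hX : HasUnitSteps (X n))
    (hS : (SimpleGraph.addCayley (blockGenerators e b)).Connected) (k : ℕ) :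
    ∀ x y : X n, dist x y ≤ k →
      (SimpleGraph.addCayley (blockGenerators e b)).dist
        (pointVector e n x) (pointVector e n y) ≤ k := by
  induction k with
  | zero =>
    intro x y h
    obtain rfl : x = y := dist_le_zero.1 (by exact_mod_cast h)
    simp
  | succ k ih =>
    intro x y h
    obtain ⟨z, h1, h2⟩ := hX k x y (by exact_mod_cast h)
    refine (hS.dist_triangle (v := pointVector e n z)).trans ?_
    rw [add_comm k]
    refine add_le_add ?_ (ih z y h2)
    by_cases hxz : pointVector e n x = pointVector e n z
    · simp [hxz]
    · refine (SimpleGraph.dist_eq_one_iff_adj.2 ?_).le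
      exact (SimpleGraph.addCayley_adj' _ _ _).2
        ⟨hxz, _, Or.inl ⟨n, x, z, h1, rfl⟩, Or.inr (by abel)⟩

/-- The linear functional sending the basis vector of `y` to `dist x y - dist x (b n)` and
vanishing on the basis vectors of the points outside `X n` has absolute value at most `1` on the
generators, so it bounds distances in the Cayley graph from below. -/
theorem dist_le_addCayley_dist_pointVector {n : ℕ}
    (hS : (SimpleGraph.addCayley (blockGenerators e b)).Connected) (x y : X n) :
    dist x y ≤ (SimpleGraph.addCayley (blockGenerators e b)).dist
        (pointVector e n x) (pointVector e n y) := by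
  classical
  let c : (Σ n, X n) → ℝ := fun p =>
    if h : p.1 = n then dist x (h ▸ p.2) - dist x (b n) else 0
  let h : (ℕ →₀ ℤ) →ₗ[ℤ] ℝ := Finsupp.linearCombination ℤ (fun i => c (e.symm i))
  have hc : ∀ m (z : X m), h (pointVector e m z) = c ⟨m, z⟩ := by
    intro m z
    simp [h, pointVector]
  have hcn : ∀ z : X n, c ⟨n, z⟩ = dist x z - dist x (b n) := fun z => by simp [c]
  have hcm : ∀ m (z : X m), m ≠ n → c ⟨m, z⟩ = 0 := fun m z hm => by simp [c, hm]
  have key := abs_sub_le_addCayley_dist hS h.toAddMonoidHom ?_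
    (pointVector e n x) (pointVector e n y)
  · refine le_trans ?_ key
    simp only [LinearMap.toAddMonoidHom_coe, hc, hcn, dist_self]
    rw [abs_sub_comm]
    refine le_trans (le_of_eq ?_) (le_abs_self _)
    ring
  · rintro s (⟨m, u, v, huv, rfl⟩ | ⟨m, rfl⟩)
    · simp only [LinearMap.toAddMonoidHom_coe, map_sub, hc]
      by_cases hm : m = n
      · subst hm
        rw [hcn, hcn, sub_sub_sub_cancel_right]
        refine le_trans ?_ huv
        rw [dist_comm x u, dist_comm x v]
        exact abs_dist_sub_le u v x
      · simp [hcm _ _ hm]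
    · simp only [LinearMap.toAddMonoidHom_coe, hc]
      by_cases hm : m = n
      · subst hm
        simp [hcn]
      · simp [hcm _ _ hm]

theorem isometry_pointVector {n : ℕ} (hX : HasUnitSteps (X n))
    (hd : ∀ x y : X n, ∃ k : ℕ, dist x y = k)
    (hS : AddSubgroup.closure (blockGenerators e b) = ⊤) :
    Isometry (β := Cay (blockGenerators e b) hS) (pointVector e n) := by
  refine Isometry.of_dist_eq fun x y => ?_
  obtain ⟨k, hk⟩ := hd x y
  refine le_antisymm ?_ (dist_le_addCayley_dist_pointVector (addCayley_connected hS) x y)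
  rw [hk]
  exact Nat.cast_le.2 (addCayley_dist_pointVector_le hX (addCayley_connected hS) k x y hk.le)

end Generators

/-- Any sequence of countable metric spaces that are integer valued and geodesic embeds in a Cayley
graph of the free abelian group of countable rank. -/
theorem exists_generating_set_isometry (X : ℕ → Type*) [∀ n, MetricSpace (X n)]
    [∀ n, Countable (X n)] [∀ n, Nonempty (X n)] (hX : ∀ n, HasUnitSteps (X n))
    (hd : ∀ n, ∀ x y : X n, ∃ k : ℕ, dist x y = k) :
    ∃ (S : Set (ℕ →₀ ℤ)) (hS : AddSubgroup.closure S = ⊤),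
      ∀ n, ∃ φ : X n → Cay S hS, Isometry φ := by
  have : Infinite (Σ n, X n) := Infinite.of_surjective Sigma.fst fun n =>
    ⟨⟨n, Classical.arbitrary _⟩, rfl⟩
  obtain ⟨_⟩ := nonempty_denumerable (Σ n, X n)
  let e : (Σ n, X n) ≃ ℕ := Denumerable.eqv _
  let b : ∀ n, X n := fun n => Classical.arbitrary _
  exact ⟨blockGenerators e b, closure_blockGenerators hX,
    fun n => ⟨pointVector e n, isometry_pointVector (hX n) (hd n) _⟩⟩

/-! ### Integer points of the cyclic spaces -/

instance (n : ℕ) : NeZero (n ^ n) := ⟨by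
  rcases Nat.eq_zero_or_pos n with rfl | h
  · simp
  · positivity⟩

/-- The point `a + 1` of `L_n`, where `0 ≤ a < nⁿ` represents a residue class. -/
noncomputable def cyclicPoint (n : ℕ) (a : ZMod (n ^ n)) : CyclicSet n :=
  ⟨(a.val : ℝ) + 1, (a.val + 1) * n ^ n,
    Nat.mul_pos (Nat.succ_pos _) (Nat.pos_of_ne_zero (NeZero.ne _)), by
      rw [two_mul, pow_add]
      exact Nat.mul_le_mul_right _ (ZMod.val_lt a), by
      have := (CyclicSet.pow_self_pos n).ne'
      push_cast
      field_simp⟩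

theorem cyclicPoint_val (n : ℕ) (a : ZMod (n ^ n)) : (cyclicPoint n a).val = (a.val : ℝ) + 1 := rfl

theorem dist_cyclicPoint (n : ℕ) (a b : ZMod (n ^ n)) :
    dist (cyclicPoint n a) (cyclicPoint n b) = ((b - a).valMinAbs.natAbs : ℝ) := by
  wlog h : a.val ≤ b.val generalizing a b
  · rw [dist_comm, this b a (le_of_not_ge h), ← neg_sub b a, ZMod.natAbs_valMinAbs_neg]
  have h1 : (b - a).val = b.val - a.val := ZMod.val_sub h
  have h2 : b.val < n ^ n := ZMod.val_lt b
  rw [ZMod.valMinAbs_natAbs_eq_min, h1, CyclicSet.dist_def, cyclicPoint_val, cyclicPoint_val,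
    Nat.cast_min, Nat.cast_sub h, Nat.cast_sub (show b.val - a.val ≤ n ^ n by omega),
    Nat.cast_sub h, abs_sub_comm, add_sub_add_right_eq_sub,
    abs_of_nonneg (by rw [sub_nonneg]; exact_mod_cast h)]
  push_cast
  rfl

theorem exists_cyclicPoint_eq {n : ℕ} (x : CyclicSet n) (hx : ∃ z : ℤ, x.val = z) :
    ∃ a, cyclicPoint n a = x := by
  obtain ⟨z, hz⟩ := hx
  have h1 : (0 : ℝ) < z := hz ▸ x.val_pos
  have h2 : (z : ℝ) ≤ (n : ℝ) ^ n := hz ▸ x.val_le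
  have h3 : 0 < z := by exact_mod_cast h1
  have h4 : z ≤ ((n ^ n : ℕ) : ℤ) := by exact_mod_cast h2
  obtain ⟨k, rfl⟩ : ∃ k : ℕ, z = k + 1 := ⟨(z - 1).toNat, by omega⟩
  refine ⟨(k : ZMod (n ^ n)), CyclicSet.ext ?_⟩
  rw [cyclicPoint_val, hz, ZMod.val_natCast_of_lt (by omega)]
  push_cast
  rfl

/-- The points of `M_n` with integer coordinates, parametrized by the torus `(ℤ/nⁿ)^(nⁿ)`. -/
noncomputable def torusPoint (n : ℕ) (g : Fin (n ^ n) → ZMod (n ^ n)) : IntegerPoints n :=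
  ⟨fun i => cyclicPoint n (g i), fun i => ⟨(g i).val + 1, by rw [cyclicPoint_val]; push_cast; rfl⟩⟩

theorem torusPoint_surjective (n : ℕ) : Function.Surjective (torusPoint n) := by
  intro x
  choose a ha using fun i => exists_cyclicPoint_eq (x.1 i) (x.2 i)
  exact ⟨a, Subtype.ext (funext ha)⟩

theorem dist_torusPoint_le_iff (n : ℕ) (g h : Fin (n ^ n) → ZMod (n ^ n)) (r : ℕ) :
    dist (torusPoint n g) (torusPoint n h) ≤ r ↔ ∀ i, (h i - g i).valMinAbs.natAbs ≤ r := by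
  rw [Subtype.dist_eq, dist_pi_le_iff (Nat.cast_nonneg r)]
  refine forall_congr' fun i => ?_
  rw [torusPoint, torusPoint, dist_cyclicPoint, Nat.cast_le]

theorem natAbs_le_dist_torusPoint (n : ℕ) (g h : Fin (n ^ n) → ZMod (n ^ n)) (i : Fin (n ^ n)) :
    ((h i - g i).valMinAbs.natAbs : ℝ) ≤ dist (torusPoint n g) (torusPoint n h) := by
  rw [← dist_cyclicPoint]
  exact dist_le_pi_dist (torusPoint n g).1 (torusPoint n h).1 i

theorem natAbs_valMinAbs_intCast_le {m : ℕ} [NeZero m] (z : ℤ) :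
    (z : ZMod m).valMinAbs.natAbs ≤ z.natAbs :=
  ZMod.natAbs_min_of_le_div_two m _ z (ZMod.coe_valMinAbs _) (ZMod.natAbs_valMinAbs_le _)

theorem integerPoints_hasUnitSteps (n : ℕ) : HasUnitSteps (IntegerPoints n) := by
  intro k x y hxy
  obtain ⟨g, rfl⟩ := torusPoint_surjective n x
  obtain ⟨h, rfl⟩ := torusPoint_surjective n y
  have hgh := (dist_torusPoint_le_iff n g h (k + 1)).1 (by exact_mod_cast hxy)
  -- Every coordinate moves one step along a shortest arc of the circle.
  refine ⟨torusPoint n fun i => g i + ((h i - g i).valMinAbs.sign : ℤ), ?_, ?_⟩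
  · rw [← Nat.cast_one, dist_torusPoint_le_iff]
    intro i
    rw [add_sub_cancel_left]
    refine (natAbs_valMinAbs_intCast_le _).trans ?_
    rw [Int.natAbs_sign]
    split_ifs <;> simp
  · rw [dist_torusPoint_le_iff]
    intro i
    specialize hgh i
    set δ := (h i - g i).valMinAbs with hδ
    have : h i - (g i + (δ.sign : ℤ)) = ((δ - δ.sign : ℤ) : ZMod (n ^ n)) := by
      push_cast
      rw [hδ, ZMod.coe_valMinAbs]
      ring
    rw [this]
    refine (natAbs_valMinAbs_intCast_le _).trans ?_
    rcases lt_trichotomy δ 0 with h0 | h0 | h0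
    · rw [Int.sign_eq_neg_one_of_neg h0]; omega
    · rw [h0]; simp
    · rw [Int.sign_eq_one_of_pos h0]; omega

theorem exists_nat_dist_integerPoints (n : ℕ) (x y : IntegerPoints n) :
    ∃ k : ℕ, dist x y = k := by
  obtain ⟨g, rfl⟩ := torusPoint_surjective n x
  obtain ⟨h, rfl⟩ := torusPoint_surjective n y
  obtain ⟨i, -, hi⟩ := Finset.exists_max_image Finset.univ
    (fun i => (h i - g i).valMinAbs.natAbs)
    (Finset.univ_nonempty_iff.2 ⟨⟨0, Nat.pos_of_ne_zero (NeZero.ne (n ^ n))⟩⟩)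
  exact ⟨_, le_antisymm ((dist_torusPoint_le_iff n g h _).2 fun j => hi j (Finset.mem_univ j))
    (natAbs_le_dist_torusPoint n g h i)⟩

/-! ### Averaging over the symmetries of a torus -/

section Torus

variable {ι : Type*} {N : ℕ}

/-- The action of a signed permutation of the coordinates on the torus `(ℤ/N)^ι`. -/
def signedPerm (σ : Equiv.Perm ι) (ε : ι → ℤˣ) (v : ι → ZMod N) : ι → ZMod N :=
  fun i => ε i • v (σ i)

theorem signedPerm_sub (σ : Equiv.Perm ι) (ε : ι → ℤˣ) (v w : ι → ZMod N) :
    signedPerm σ ε (v - w) = signedPerm σ ε v - signedPerm σ ε w :=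
  funext fun _ => smul_sub _ _ _

/-- The vectors whose coordinates are `±r` on a set of `s` coordinates and `0` elsewhere. -/
def HasShape (s : ℕ) (r : ZMod N) (v : ι → ZMod N) : Prop :=
  ∃ A : Finset ι, A.card = s ∧ (∀ i ∈ A, v i = r ∨ v i = -r) ∧ ∀ i ∉ A, v i = 0

theorem HasShape.signedPerm {s : ℕ} {r : ZMod N} {v : ι → ZMod N} (hv : HasShape s r v)
    (σ : Equiv.Perm ι) (ε : ι → ℤˣ) : HasShape s r (signedPerm σ ε v) := by
  obtain ⟨A, hA, h1, h2⟩ := hv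
  refine ⟨A.map σ.symm.toEmbedding, by rw [Finset.card_map, hA], fun i hi => ?_, fun i hi => ?_⟩
  · have hi' : σ i ∈ A := by simpa [Finset.mem_map_equiv] using hi
    rcases Int.units_eq_one_or (ε i) with h | h <;> rcases h1 _ hi' with h' | h' <;>
      simp [Roundness.signedPerm, h, h']
  · have hi' : σ i ∉ A := by simpa [Finset.mem_map_equiv] using hi
    simp [Roundness.signedPerm, h2 _ hi']

/-- Signed permutations act transitively on the vectors of a given shape. -/
theorem HasShape.exists_signedPerm_eq [Finite ι] {s : ℕ} {r : ZMod N} {v w : ι → ZMod N}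
    (hv : HasShape s r v) (hw : HasShape s r w) : ∃ σ ε, Roundness.signedPerm σ ε v = w := by
  classical
  obtain ⟨A, hA, h1, h2⟩ := hv
  obtain ⟨A', hA', h1', h2'⟩ := hw
  let e : {i // i ∈ A'} ≃ {i // i ∈ A} := Finset.equivOfCardEq (hA'.trans hA.symm)
  let σ : Equiv.Perm ι := e.extendSubtype
  have key : ∀ i, ∃ ε : ℤˣ, ε • v (σ i) = w i := by
    intro i
    by_cases hi : i ∈ A'
    · rcases h1 _ (e.extendSubtype_mem i hi) with h | h <;> rcases h1' i hi with h' | h'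
      · exact ⟨1, by simp [σ, h, h']⟩
      · exact ⟨-1, by simp [σ, h, h']⟩
      · exact ⟨-1, by simp [σ, h, h']⟩
      · exact ⟨1, by simp [σ, h, h']⟩
    · exact ⟨1, by rw [h2 _ (e.extendSubtype_not_mem i hi), h2' i hi, smul_zero]⟩
  choose ε hε using key
  exact ⟨σ, ε, funext hε⟩

theorem exists_hasShape [Fintype ι] {s : ℕ} (hs : s ≤ Fintype.card ι) (r : ZMod N) :
    ∃ v : ι → ZMod N, HasShape s r v := by
  classical
  obtain ⟨A, -, hA⟩ := Finset.exists_subset_card_eq (s := (Finset.univ : Finset ι)) hs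
  exact ⟨fun i => if i ∈ A then r else 0, A, hA, fun i hi => Or.inl (if_pos hi),
    fun i hi => if_neg hi⟩

variable {B : Type*} [MetricSpace B] [Fintype ι] [DecidableEq ι] [NeZero N]

/-- The sum, over the base points `g` and over the signed permutations of the coordinates, of
`d(F(g), F(g + v))^p`, where `v` is moved by the signed permutation. -/
noncomputable def averagedPower (F : (ι → ZMod N) → B) (p : ℝ) (v : ι → ZMod N) : ℝ :=
  ∑ q : (Equiv.Perm ι × (ι → ℤˣ)) × (ι → ZMod N),
    dist (F q.2) (F (q.2 + signedPerm q.1.1 q.1.2 v)) ^ p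

theorem averagedPower_signedPerm (F : (ι → ZMod N) → B) (p : ℝ) (τ : Equiv.Perm ι) (δ : ι → ℤˣ)
    (v : ι → ZMod N) : averagedPower F p (signedPerm τ δ v) = averagedPower F p v := by
  simp only [averagedPower, Fintype.sum_prod_type]
  symm
  rw [← Equiv.sum_comp (Equiv.mulLeft τ)]
  refine Finset.sum_congr rfl fun σ _ => ?_
  rw [← Equiv.sum_comp (Equiv.mulRight fun i => δ (σ i))]
  refine Finset.sum_congr rfl fun ε _ => Finset.sum_congr rfl fun g _ => ?_
  have : signedPerm σ ε (signedPerm τ δ v) =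
      signedPerm (Equiv.mulLeft τ σ) (Equiv.mulRight (fun i => δ (σ i)) ε) v :=
    funext fun i => smul_smul (ε i) (δ (σ i)) _
  simp only [this]

theorem averagedPower_eq_of_hasShape (F : (ι → ZMod N) → B) (p : ℝ) {s : ℕ} {r : ZMod N}
    {v w : ι → ZMod N} (hv : HasShape s r v) (hw : HasShape s r w) :
    averagedPower F p v = averagedPower F p w := by
  obtain ⟨σ, ε, rfl⟩ := hv.exists_signedPerm_eq hw
  rw [averagedPower_signedPerm]

theorem averagedPower_sub (F : (ι → ZMod N) → B) (p : ℝ) (v w : ι → ZMod N) :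
    averagedPower F p (w - v) = ∑ q : (Equiv.Perm ι × (ι → ℤˣ)) × (ι → ZMod N),
      dist (F (q.2 + signedPerm q.1.1 q.1.2 v)) (F (q.2 + signedPerm q.1.1 q.1.2 w)) ^ p := by
  simp only [averagedPower, Fintype.sum_prod_type]
  refine Finset.sum_congr rfl fun σ _ => Finset.sum_congr rfl fun ε _ => ?_
  symm
  refine Fintype.sum_equiv (Equiv.addRight (signedPerm σ ε v)) _ _ fun g => ?_
  simp only [Equiv.coe_addRight, signedPerm_sub]
  rw [add_assoc, add_sub_cancel]

/-- The averaged powers inherit the generalized roundness inequality. -/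
theorem averagedPower_roundness {p : ℝ≥0} (hB : HasRoundnessExponent B p) (F : (ι → ZMod N) → B)
    {m : ℕ} (hm : 2 ≤ m) (a b : Fin m → ι → ZMod N) :
    ∑ i, ∑ j ∈ Finset.Ioi i, (averagedPower F p (a j - a i) + averagedPower F p (b j - b i)) ≤
      ∑ i, ∑ j, averagedPower F p (b j - a i) := by
  have swap : ∀ (s : Fin m → Finset (Fin m))
      (f : Fin m → Fin m → (Equiv.Perm ι × (ι → ℤˣ)) × (ι → ZMod N) → ℝ),
      ∑ i, ∑ j ∈ s i, ∑ q, f i j q = ∑ q, ∑ i, ∑ j ∈ s i, f i j q := fun s f =>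
    (Finset.sum_congr rfl fun i _ => Finset.sum_comm).trans Finset.sum_comm
  simp only [averagedPower_sub, ← Finset.sum_add_distrib]
  rw [swap, swap]
  exact Finset.sum_le_sum fun q _ => hB m hm _ _

theorem sum_card_Ioi (m : ℕ) : ∑ i : Fin m, ((Finset.Ioi i).card : ℝ) * 2 = m * (m - 1) := by
  rcases Nat.eq_zero_or_pos m with rfl | hm
  · simp
  have h1 : ∑ i : Fin m, (Finset.Ioi i).card = ∑ i ∈ Finset.range m, i := by
    simp only [Fin.card_Ioi]
    rw [Fin.sum_univ_eq_sum_range fun i => m - 1 - i, Finset.sum_range_reflect (fun i => i)]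
  have h2 := Finset.sum_range_id_mul_two m
  rw [← h1] at h2
  rw [← Finset.sum_mul, ← Nat.cast_pred hm]
  exact_mod_cast h2

/-- Passing to twice the distance costs at most a factor `m / (m - 1)`: take two double-simplex
sides `a`, `b` supported on disjoint sets of `m` blocks of `t` coordinates, where `a c` and `b c`
are `r` on the block `c`, `-r` on the other blocks of their side, and `0` on the opposite side. Cross
differences then have entries `±r` everywhere, while `a j - a i` is `±2r` on two blocks only. -/
theorem averagedPower_double {p : ℝ≥0} (hB : HasRoundnessExponent B p) (F : (ι → ZMod N) → B)
    {m t : ℕ} (hm : 2 ≤ m) (ht : 2 * (m * t) ≤ Fintype.card ι) {r : ZMod N} {v w : ι → ZMod N}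
    (hv : HasShape (2 * (m * t)) r v) (hw : HasShape (2 * t) (2 * r) w) :
    ((m : ℝ) - 1) * averagedPower F p w ≤ m * averagedPower F p v := by
  obtain ⟨f⟩ : Nonempty ((Fin m × Fin t) ⊕ (Fin m × Fin t) ↪ ι) :=
    Function.Embedding.nonempty_of_card_le (by simpa [two_mul] using ht)
  let z : Fin m → Fin m × Fin t → ZMod N := fun c d => if d.1 = c then r else -r
  let a : Fin m → ι → ZMod N := fun c => Function.extend f (Sum.elim (z c) fun _ => 0) 0
  let b : Fin m → ι → ZMod N := fun c => Function.extend f (Sum.elim (fun _ => 0) (z c)) 0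
  have haf : ∀ c d, a c (f d) = Sum.elim (z c) (fun _ => 0) d :=
    fun c d => f.injective.extend_apply _ _ d
  have hbf : ∀ c d, b c (f d) = Sum.elim (fun _ => 0) (z c) d :=
    fun c d => f.injective.extend_apply _ _ d
  have ha0 : ∀ c i, (¬ ∃ d, f d = i) → a c i = 0 := fun c i hi => Function.extend_apply' _ _ _ hi
  have hb0 : ∀ c i, (¬ ∃ d, f d = i) → b c i = 0 := fun c i hi => Function.extend_apply' _ _ _ hi
  have hz : ∀ c d, z c d = r ∨ z c d = -r := fun c d => by
    by_cases h : d.1 = c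
    · exact Or.inl (if_pos h)
    · exact Or.inr (if_neg h)
  have hab : ∀ i j, HasShape (2 * (m * t)) r (b j - a i) := by
    intro i j
    refine ⟨Finset.univ.map f, by simp [two_mul], ?_, ?_⟩
    · simp only [Finset.mem_map, Finset.mem_univ, true_and]
      rintro _ ⟨d | d, rfl⟩
      · rcases hz i d with h | h <;> simp [haf, hbf, h]
      · rcases hz j d with h | h <;> simp [haf, hbf, h]
    · intro k hk
      have hk' : ¬ ∃ d, f d = k := by simpa using hk
      simp [ha0 _ _ hk', hb0 _ _ hk']
  have hcard : ∀ i j : Fin m, i ≠ j →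
      ((({i, j} : Finset (Fin m)) ×ˢ (Finset.univ : Finset (Fin t))).card) = 2 * t := by
    intro i j hij
    simp [Finset.card_pair hij]
  have hzz : ∀ i j d, i ≠ j → (d.1 = i ∨ d.1 = j) →
      z j d - z i d = 2 * r ∨ z j d - z i d = -(2 * r) := by
    rintro i j d hij (h | h)
    · right; simp only [z, h, if_neg hij, if_true]; ring
    · left; simp only [z, h, if_neg hij.symm, if_true]; ring
  have hzn : ∀ i j d, ¬ (d.1 = i ∨ d.1 = j) → z j d - z i d = 0 := by
    intro i j d h
    simp only [not_or] at h
    simp [z, h.1, h.2]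
  have haa : ∀ i j, i ≠ j → HasShape (2 * t) (2 * r) (a j - a i) := by
    intro i j hij
    refine ⟨(({i, j} : Finset (Fin m)) ×ˢ (Finset.univ : Finset (Fin t))).map
      (Function.Embedding.inl.trans f), by rw [Finset.card_map, hcard i j hij], ?_, ?_⟩
    · intro k hk
      obtain ⟨d, hd, rfl⟩ := Finset.mem_map.1 hk
      simpa [haf] using hzz i j d hij (by simpa using hd)
    · intro k hk
      by_cases hk' : ∃ d, f d = k
      · obtain ⟨d | d, rfl⟩ := hk'
        · simpa [haf] using hzn i j d fun h => hk (Finset.mem_map.2 ⟨d, by simpa using h, rfl⟩)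
        · simp [haf]
      · simp [ha0 _ _ hk']
  have hbb : ∀ i j, i ≠ j → HasShape (2 * t) (2 * r) (b j - b i) := by
    intro i j hij
    refine ⟨(({i, j} : Finset (Fin m)) ×ˢ (Finset.univ : Finset (Fin t))).map
      (Function.Embedding.inr.trans f), by rw [Finset.card_map, hcard i j hij], ?_, ?_⟩
    · intro k hk
      obtain ⟨d, hd, rfl⟩ := Finset.mem_map.1 hk
      simpa [hbf] using hzz i j d hij (by simpa using hd)
    · intro k hk
      by_cases hk' : ∃ d, f d = k
      · obtain ⟨d | d, rfl⟩ := hk'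
        · simp [hbf]
        · simpa [hbf] using hzn i j d fun h => hk (Finset.mem_map.2 ⟨d, by simpa using h, rfl⟩)
      · simp [hb0 _ _ hk']
  have main := averagedPower_roundness hB F hm a b
  have hl : ∑ i, ∑ j ∈ Finset.Ioi i,
      (averagedPower F p (a j - a i) + averagedPower F p (b j - b i)) =
      (m * (m - 1)) * averagedPower F p w := by
    rw [← sum_card_Ioi, Finset.sum_mul]
    refine Finset.sum_congr rfl fun i _ => ?_
    rw [mul_assoc, ← nsmul_eq_mul]
    refine Finset.sum_eq_card_nsmul fun j hj => ?_
    have hij : i ≠ j := (Finset.mem_Ioi.1 hj).ne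
    rw [averagedPower_eq_of_hasShape F p (haa i j hij) hw,
      averagedPower_eq_of_hasShape F p (hbb i j hij) hw, two_mul]
  have hr : ∑ i, ∑ j, averagedPower F p (b j - a i) = m * (m * averagedPower F p v) := by
    simp only [averagedPower_eq_of_hasShape F p (hab _ _) hv, Finset.sum_const, Finset.card_univ,
      Fintype.card_fin, nsmul_eq_mul]
  rw [hl, hr, mul_assoc] at main
  exact le_of_mul_le_mul_left main (by exact_mod_cast (by omega : 0 < m))

theorem averagedPower_double_iterate {p : ℝ≥0} (hB : HasRoundnessExponent B p)
    (F : (ι → ZMod N) → B) {m : ℕ} (hm : 2 ≤ m) {r : ZMod N} (k : ℕ) :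
    ∀ (t : ℕ) {v w : ι → ZMod N}, 2 * (m ^ k * t) ≤ Fintype.card ι →
      HasShape (2 * (m ^ k * t)) r v → HasShape (2 * t) (2 ^ k * r) w →
      ((m : ℝ) - 1) ^ k * averagedPower F p w ≤ m ^ k * averagedPower F p v := by
  induction k with
  | zero =>
    intro t v w _ hv hw
    rw [pow_zero, one_mul] at hv hw
    simp [averagedPower_eq_of_hasShape F p hv hw]
  | succ k ih =>
    intro t v w ht hv hw
    rw [pow_succ, mul_assoc] at ht hv
    have hmt : 2 * (m * t) ≤ Fintype.card ι :=
      le_trans (Nat.mul_le_mul_left 2 (Nat.le_mul_of_pos_left _ (by positivity))) ht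
    obtain ⟨u, hu⟩ := exists_hasShape (N := N) hmt (2 ^ k * r)
    rw [pow_succ', mul_assoc] at hw
    have h1 := ih (m * t) ht hv hu
    have h2 := averagedPower_double hB F hm hmt hu hw
    have hm' : (0 : ℝ) ≤ (m : ℝ) - 1 := by
      rw [sub_nonneg]
      exact_mod_cast (by omega : 1 ≤ m)
    calc ((m : ℝ) - 1) ^ (k + 1) * averagedPower F p w
        = ((m : ℝ) - 1) ^ k * (((m : ℝ) - 1) * averagedPower F p w) := by ring
      _ ≤ ((m : ℝ) - 1) ^ k * (m * averagedPower F p u) := by gcongr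
      _ = m * (((m : ℝ) - 1) ^ k * averagedPower F p u) := by ring
      _ ≤ m * (m ^ k * averagedPower F p v) := by gcongr
      _ = m ^ (k + 1) * averagedPower F p v := by ring

/-- Enflo's estimate for maps of a torus to a space with a roundness exponent: distances at scale
`2 ^ k` are controlled by distances at scale `1`. -/
theorem pow_mul_le_of_hasRoundnessExponent {p : ℝ≥0} (hB : HasRoundnessExponent B p)
    (F : (ι → ZMod N) → B) {m : ℕ} (hm : 2 ≤ m) (k : ℕ) (hk : 2 * m ^ k ≤ Fintype.card ι)
    {C L : ℝ}
    (hC : ∀ g v, HasShape (2 * m ^ k) 1 v → dist (F g) (F (g + v)) ^ (p : ℝ) ≤ C)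
    (hL : ∀ g v, HasShape 2 (2 ^ k) v → L ≤ dist (F g) (F (g + v)) ^ (p : ℝ)) :
    ((m : ℝ) - 1) ^ k * L ≤ m ^ k * C := by
  have h2 : 2 ≤ Fintype.card ι := by
    have : 0 < m ^ k := by positivity
    omega
  obtain ⟨v, hv⟩ := exists_hasShape (N := N) hk 1
  obtain ⟨w, hw⟩ := exists_hasShape (N := N) h2 (2 ^ k)
  have main := averagedPower_double_iterate hB F hm k 1 (r := 1) (v := v) (w := w)
    (by rwa [mul_one]) (by rwa [mul_one]) (by rwa [mul_one, mul_one])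
  have hm' : (0 : ℝ) ≤ (m : ℝ) - 1 := by
    rw [sub_nonneg]
    exact_mod_cast (by omega : 1 ≤ m)
  set K := Fintype.card ((Equiv.Perm ι × (ι → ℤˣ)) × (ι → ZMod N)) with hKdef
  have hK : (0 : ℝ) < K := by exact_mod_cast Fintype.card_pos
  have hv' : averagedPower F p v ≤ K * C := by
    rw [← nsmul_eq_mul]
    exact Finset.sum_le_card_nsmul _ _ _ fun q _ => hC _ _ (hv.signedPerm _ _)
  have hw' : K * L ≤ averagedPower F p w := by
    rw [← nsmul_eq_mul]
    exact Finset.card_nsmul_le_sum _ _ _ fun q _ => hL _ _ (hw.signedPerm _ _)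
  refine le_of_mul_le_mul_left ?_ hK
  calc K * (((m : ℝ) - 1) ^ k * L) = ((m : ℝ) - 1) ^ k * (K * L) := by ring
    _ ≤ ((m : ℝ) - 1) ^ k * averagedPower F p w := by gcongr
    _ ≤ m ^ k * averagedPower F p v := main
    _ ≤ m ^ k * (K * C) := by gcongr
    _ = K * (m ^ k * C) := by ring

end Torus

/-! ### Obstruction to coarse embeddings -/

theorem exists_hasRoundnessExponent_pos {B : Type*} [MetricSpace B]
    (hB : generalizedRoundness B ≠ 0) : ∃ p : ℝ≥0, 0 < p ∧ HasRoundnessExponent B p := by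
  by_contra! h
  refine hB (le_antisymm (iSup₂_le fun p hp => ?_) zero_le)
  by_contra! hp'
  exact h p (by exact_mod_cast hp') hp

theorem natAbs_valMinAbs_of_hasShape_one {ι : Type*} {N s : ℕ} [NeZero N] {v : ι → ZMod N}
    (hv : HasShape s 1 v) (i : ι) : (v i).valMinAbs.natAbs ≤ 1 := by
  obtain ⟨A, -, h1, h2⟩ := hv
  by_cases hi : i ∈ A
  · have h : (1 : ZMod N).valMinAbs.natAbs ≤ 1 := by
      simpa using natAbs_valMinAbs_intCast_le (m := N) 1
    rcases h1 i hi with h' | h' <;> rw [h']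
    · exact h
    · rwa [ZMod.natAbs_valMinAbs_neg]
  · simp [h2 i hi]

theorem exists_natAbs_valMinAbs_of_hasShape {ι : Type*} {N s r : ℕ} [NeZero N] {v : ι → ZMod N}
    (hs : s ≠ 0) (hr : r ≤ N / 2) (hv : HasShape s (r : ZMod N) v) :
    ∃ i, (v i).valMinAbs.natAbs = r := by
  obtain ⟨A, hA, h1, -⟩ := hv
  obtain ⟨i, hi⟩ : A.Nonempty := Finset.card_ne_zero.1 (hA.trans_ne hs)
  refine ⟨i, ?_⟩
  rcases h1 i hi with h' | h' <;> rw [h']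
  · rw [ZMod.valMinAbs_natCast_of_le_half hr, Int.natAbs_natCast]
  · rw [ZMod.natAbs_valMinAbs_neg, ZMod.valMinAbs_natCast_of_le_half hr, Int.natAbs_natCast]

theorem add_two_pow_le (k : ℕ) : ((k : ℝ) + 2) ^ k ≤ 3 * ((k : ℝ) + 1) ^ k := by
  have hk : (0 : ℝ) < (k : ℝ) + 1 := by positivity
  have h1 : ((k : ℝ) + 2) / (k + 1) ≤ Real.exp (1 / (k + 1)) := by
    have := Real.add_one_le_exp (1 / ((k : ℝ) + 1))
    have h : ((k : ℝ) + 2) / (k + 1) = 1 / (k + 1) + 1 := by field_simp; ring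
    rwa [h]
  have h2 : (((k : ℝ) + 2) / (k + 1)) ^ k ≤ 3 := by
    calc (((k : ℝ) + 2) / (k + 1)) ^ k ≤ Real.exp (1 / (k + 1)) ^ k := by gcongr
      _ = Real.exp (k * (1 / (k + 1))) := (Real.exp_nat_mul _ _).symm
      _ ≤ Real.exp 1 := by
        refine Real.exp_le_exp.2 ?_
        rw [mul_one_div, div_le_one hk]
        linarith
      _ ≤ 3 := Real.exp_one_lt_three.le
  rwa [div_pow, div_le_iff₀ (by positivity)] at h2

/-- A space containing isometric copies of `M_n^*` for arbitrarily large `n` does not embed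
coarsely into a space of non-zero generalized roundness. -/
theorem not_isCoarseEmbedding_of_isometry {Y B : Type*} [MetricSpace Y] [MetricSpace B]
    (hY : ∀ N : ℕ, ∃ n : ℕ, N ≤ n ∧ ∃ φ : IntegerPoints n → Y, Isometry φ)
    (hB : generalizedRoundness B ≠ 0) (f : Y → B) : ¬ IsCoarseEmbedding f := by
  rintro ⟨ρ₁, ρ₂, hρ₁, hρ₂, hρ, hlim⟩
  obtain ⟨p, hp, hBp⟩ := exists_hasRoundnessExponent_pos hB
  have hp' : (0 : ℝ) < p := by exact_mod_cast hp
  -- A scale `2 ^ k` at which the lower control function beats the factor `3` of `add_two_pow_le`.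
  obtain ⟨k, hk⟩ : ∃ k : ℕ, 3 * (ρ₂ 1 : ℝ) ^ (p : ℝ) < (ρ₁ (2 ^ k) : ℝ) ^ (p : ℝ) := by
    have h1 : Filter.Tendsto (fun k : ℕ => (2 : ℝ≥0) ^ k) Filter.atTop Filter.atTop :=
      tendsto_pow_atTop_atTop_of_one_lt one_lt_two
    have h2 := (tendsto_rpow_atTop hp').comp
      (NNReal.tendsto_coe_atTop.2 (hlim.comp h1))
    exact (h2.eventually_gt_atTop _).exists
  obtain ⟨n, hn, φ, hφ⟩ := hY (2 * (k + 2) ^ k + 2 ^ k * 2)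
  -- The number `nⁿ` of coordinates is at least `2 (k + 2) ^ k`, and `2 ^ k` is at most half of `nⁿ`.
  have hn' : n ≤ n ^ n := by
    rcases Nat.eq_zero_or_pos n with rfl | h
    · exact Nat.zero_le _
    · exact Nat.le_self_pow h.ne' n
  have hr : 2 ^ k ≤ n ^ n / 2 := by
    rw [Nat.le_div_iff_mul_le two_pos]
    omega
  have main := pow_mul_le_of_hasRoundnessExponent hBp (fun g => f (φ (torusPoint n g)))
    (m := k + 2) (by omega) k (by rw [Fintype.card_fin]; omega)
    (C := (ρ₂ 1 : ℝ) ^ (p : ℝ)) (L := (ρ₁ (2 ^ k) : ℝ) ^ (p : ℝ)) ?_ ?_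
  · push_cast at main
    rw [add_sub_assoc, show (2 : ℝ) - 1 = 1 by norm_num] at main
    have h1 : ((k : ℝ) + 2) ^ k * (ρ₂ 1 : ℝ) ^ (p : ℝ) ≤
        3 * ((k : ℝ) + 1) ^ k * (ρ₂ 1 : ℝ) ^ (p : ℝ) := by
      gcongr
      exact add_two_pow_le k
    have h2 : (0 : ℝ) < ((k : ℝ) + 1) ^ k := by positivity
    nlinarith [mul_lt_mul_of_pos_left hk h2]
  · intro g v hv
    have hd : dist (torusPoint n g) (torusPoint n (g + v)) ≤ 1 := by
      rw [← Nat.cast_one, dist_torusPoint_le_iff]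
      intro i
      rw [Pi.add_apply, add_sub_cancel_left]
      exact natAbs_valMinAbs_of_hasShape_one hv i
    rw [← hφ.dist_eq, ← coe_nndist, ← NNReal.coe_one, NNReal.coe_le_coe] at hd
    refine Real.rpow_le_rpow dist_nonneg ?_ p.2
    rw [← coe_nndist, NNReal.coe_le_coe]
    exact (hρ _ _).2.trans (hρ₂ hd)
  · intro g v hv
    obtain ⟨i, hi⟩ := exists_natAbs_valMinAbs_of_hasShape (r := 2 ^ k) two_ne_zero hr
      (by exact_mod_cast hv)
    have hd := natAbs_le_dist_torusPoint n g (g + v) i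
    rw [Pi.add_apply, add_sub_cancel_left, hi, ← hφ.dist_eq, ← coe_nndist, ← NNReal.coe_natCast,
      NNReal.coe_le_coe, Nat.cast_pow, Nat.cast_ofNat] at hd
    refine Real.rpow_le_rpow (NNReal.coe_nonneg _) ?_ p.2
    rw [← coe_nndist, NNReal.coe_le_coe]
    exact (hρ₁ hd).trans (hρ _ _).1

end Roundness

/-- There is a generating set `S` of `⨁_{ℵ₀} ℤ` whose Cayley graph contains isometric copies of
`M_n^*` for arbitrarily large (even) `n`, and this Cayley graph does not coarsely embed into any
metric space of non-zero generalized roundness. -/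
theorem theorem3p4 :
    ∃ (S : Set (ℕ →₀ ℤ)) (hS : AddSubgroup.closure S = ⊤),
      (∀ N : ℕ, ∃ n : ℕ, N ≤ n ∧ Even n ∧
        ∃ φ : Roundness.IntegerPoints n → Roundness.Cay S hS, Isometry φ) ∧
      ∀ (B : Type*) [MetricSpace B], Roundness.generalizedRoundness B ≠ 0 →
        ¬ ∃ f : Roundness.Cay S hS → B, Roundness.IsCoarseEmbedding f := by
  have (n : ℕ) : Countable (Roundness.IntegerPoints n) :=
    (Roundness.torusPoint_surjective n).countable
  have (n : ℕ) : Nonempty (Roundness.IntegerPoints n) := ⟨Roundness.torusPoint n 0⟩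
  obtain ⟨S, hS, hφ⟩ := Roundness.exists_generating_set_isometry Roundness.IntegerPoints
    Roundness.integerPoints_hasUnitSteps Roundness.exists_nat_dist_integerPoints
  refine ⟨S, hS, fun N => ⟨2 * N, by omega, even_two_mul N, hφ _⟩, ?_⟩
  rintro B _ hB ⟨f, hf⟩
  exact Roundness.not_isCoarseEmbedding_of_isometry (fun N => ⟨N, le_rfl, hφ N⟩) hB f hf
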